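/- Let $K$ be a field, let $S=K[t_1,\ldots,t_s]$ be a polynomial ring, and let $\mathcal{C}$ be a clutter with vertex set $\{t_1,\ldots,t_s\}$, that is, a family of subsets (called edges) of the vertex set none of which is contained in another. Assume that $\mathcal{C}$ has at least one edge and that every edge is non-empty. Let $I=I(\mathcal{C})\subset S$ be the edge ideal of $\mathcal{C}$, i.e., the ideal generated by the squarefree monomials $\prod_{t_i\in e}t_i$, where $e$ runs over the edges of $\mathcal{C}$. Let $A$ be the incidence matrix of $\mathcal{C}$, whose columns are the characteristic vectors in $\{0,1\}^s$ of the edges, and let $$\mathcal{Q}(I)=\{x\in\mathbb{R}^s \mid x\geq 0,\ xA\geq (1,\ldots,1)\}$$ be the covering polyhedron of $I$; it is called integral if all its vertices have integer coordinates. For $n\geq 1$ let $I^{(n)}=\bigcap_{\mathfrak{p}\in{\rm Ass}(S/I)}(I^nS_{\mathfrak{p}}\cap S)$ be the $n$-th symbolic power of $I$, and let $$\rho(I)=\sup\left\{\frac{n}{r}\ \Big|\ n,r\geq 1 \text{ integers},\ I^{(n)}\not\subseteq I^r\right\}$$ be the resurgence of $I$. Then $\rho(I)=1$ if and only if $\mathcal{Q}(I)$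 is integral and $I^{(r+1)}\subseteq I^r$ for all $r=1,\ldots,s-1$. -/

import Mathlib

open scoped ENNReal Matrix

noncomputable section

/-- A clutter on the vertex set `V`: a family of subsets of `V`, called edges, none of which is
contained in another. -/
structure Clutter (V : Type*) where
  /-- The edges of the clutter. -/
  edges : Finset (Finset V)
  /-- No edge is contained in another one. -/
  antichain : IsAntichain (· ⊆ ·) (edges : Set (Finset V))

namespace Clutter

variable {V : Type*}

/-- The edge ideal of `C` in `K[t_v : v ∈ V]`, generated by the monomials `∏_{v ∈ e} t_v`, where
`e` runs over the edges of `C`. -/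
def edgeIdeal (K : Type*) [Field K] (C : Clutter V) : Ideal (MvPolynomial V K) :=
  Ideal.span {f | ∃ e ∈ C.edges, f = ∏ v ∈ e, MvPolynomial.X v}

open Classical in
/-- The incidence matrix of `C`: rows are indexed by vertices, columns by edges, and the column of
an edge is its characteristic vector. -/
def incidenceMatrix (C : Clutter V) : Matrix V C.edges ℝ :=
  Matrix.of fun v e => if v ∈ e.1 then 1 else 0

/-- The covering polyhedron `{x | x ≥ 0, x A ≥ 1}`, where `A` is the incidence matrix. -/
def coveringPolyhedron [Fintype V] (C : Clutter V) : Set (V → ℝ) :=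
  {x | 0 ≤ x ∧ 1 ≤ x ᵥ* C.incidenceMatrix}

end Clutter

/-- A polyhedron in `ℝ^V` is integral if all its vertices (extreme points) have integer
coordinates. -/
def IsIntegralPolyhedron {V : Type*} (P : Set (V → ℝ)) : Prop :=
  ∀ x ∈ P.extremePoints ℝ, ∀ v, ∃ z : ℤ, x v = z

/-- The `n`-th symbolic power `I^{(n)} = ⋂_𝔭 (I^n R_𝔭 ∩ R)`, where `𝔭` runs over the associated
primes of `R ⧸ I`. -/
def symbolicPower {R : Type*} [CommRing R] (I : Ideal R) (n : ℕ) : Ideal R :=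
  ⨅ (p : Ideal R) (_ : p.IsPrime) (_ : p ∈ associatedPrimes R (R ⧸ I)),
    ((I ^ n).map (algebraMap R (Localization.AtPrime p))).comap
      (algebraMap R (Localization.AtPrime p))

/-- The resurgence `ρ(I) = sup {n / r | n, r ≥ 1, I^{(n)} ⊄ I^r}`, as an element of `[0, ∞]`. -/
def resurgence {R : Type*} [CommRing R] (I : Ideal R) : ℝ≥0∞ :=
  sSup {q | ∃ n r : ℕ, 1 ≤ n ∧ 1 ≤ r ∧ ¬ symbolicPower I n ≤ I ^ r ∧ q = (n : ℝ≥0∞) / (r : ℝ≥0∞)}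

end

/-! Since `I ^ n ⊄ I ^ (n + 1)`, always `ρ(I) ≥ 1`, and `ρ(I) ≤ 1` means `I^{(r+1)} ⊆ I ^ r` for all
`r ≥ 1`. These containments must be compared with integrality plus the first `s - 1` of them.

The dictionary is monomial: `t^m ∈ I^{(n)}` iff `m` has degree at least `n` on every vertex cover,
while `t^m ∈ I ^ r` forces weight at least `r` against every point of `Q(I)`.

If `Q(I)` is integral, its vertices are covers, so `t^m ∈ I^{(n)}` gives weight at least `n` on all
of `Q(I)`. By duality `m` dominates `n` times a convex combination of edges, and by Carathéodory `s
+ 1` edges suffice. For `n ≥ s + 1` some coefficient is at least `1`; splitting off that edge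
(`exists_edgeExponent_le`) drives an induction on `r`.

Conversely, a vertex of `Q(I)` that dominates no convex combination of covers is separated from them
by an integral weight; multiples of it give monomials violating a containment. Any other vertex is
itself a cover, by extremality. -/

theorem mem_symbolicPower {R : Type*} [CommRing R] {I : Ideal R} {n : ℕ} {f : R} :
    f ∈ symbolicPower I n ↔
      ∀ p : Ideal R, p ∈ associatedPrimes R (R ⧸ I) → ∃ u, u ∉ p ∧ u * f ∈ I ^ n := by
  simp only [symbolicPower, Submodule.mem_iInf, Ideal.mem_comap]
  constructor
  · intro h p hp
    have := hp.1
    obtain ⟨u, hu, huf⟩ := (IsLocalization.algebraMap_mem_map_algebraMap_iff p.primeCompl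
      (Localization.AtPrime p) (I ^ n) f).1 (h p hp.1 hp)
    exact ⟨u, hu, huf⟩
  · intro h p hp hp'
    obtain ⟨u, hu, huf⟩ := h p hp'
    exact (IsLocalization.algebraMap_mem_map_algebraMap_iff p.primeCompl
      (Localization.AtPrime p) (I ^ n) f).2 ⟨u, hu, huf⟩

theorem pow_le_symbolicPower {R : Type*} [CommRing R] (I : Ideal R) (n : ℕ) :
    I ^ n ≤ symbolicPower I n := fun f hf => mem_symbolicPower.2 fun p hp =>
  ⟨1, (Ideal.ne_top_iff_one p).1 hp.1.ne_top, by simpa using hf⟩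

theorem symbolicPower_antitone {R : Type*} [CommRing R] (I : Ideal R) :
    Antitone (symbolicPower I) := by
  intro m n hmn f hf
  rw [mem_symbolicPower] at hf ⊢
  intro p hp
  obtain ⟨u, hu, huf⟩ := hf p hp
  exact ⟨u, hu, Ideal.pow_le_pow_right hmn huf⟩

/-! ### Edge ideals and weights from the covering polyhedron. -/

namespace Clutter

variable {V : Type*}

/-- A vertex cover of a clutter: a set of vertices that meets every edge. -/
def IsCover (C : Clutter V) (c : Finset V) : Prop :=
  ∀ e ∈ C.edges, ∃ v ∈ e, v ∈ c

theorem mem_coveringPolyhedron [Fintype V] {C : Clutter V} {x : V → ℝ} :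
    x ∈ C.coveringPolyhedron ↔ (∀ v, 0 ≤ x v) ∧ ∀ e ∈ C.edges, 1 ≤ ∑ v ∈ e, x v := by
  classical
  simp [coveringPolyhedron, Pi.le_def, Matrix.vecMul, dotProduct, incidenceMatrix,
    Finset.sum_ite_mem]

theorem indicator_mem_coveringPolyhedron [Fintype V] {C : Clutter V} {c : Finset V} :
    Set.indicator (c : Set V) (1 : V → ℝ) ∈ C.coveringPolyhedron ↔ C.IsCover c := by
  classical
  rw [mem_coveringPolyhedron]
  constructor
  · rintro ⟨-, h⟩ e he
    by_contra! hc
    have := h e he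
    rw [Finset.sum_eq_zero fun v hv => by simp [hc v hv]] at this
    norm_num at this
  · intro h
    have h0 : ∀ v, (0 : ℝ) ≤ Set.indicator (c : Set V) (1 : V → ℝ) v := fun v =>
      Set.indicator_nonneg (by simp) v
    refine ⟨h0, fun e he => ?_⟩
    obtain ⟨v, hv, hvc⟩ := h e he
    calc (1 : ℝ) = Set.indicator (c : Set V) (1 : V → ℝ) v := by simp [hvc]
      _ ≤ _ := Finset.single_le_sum (fun i _ => h0 i) hv

/-- The exponent vector of the squarefree monomial of an edge. -/
noncomputable def edgeExponent (e : Finset V) : V →₀ ℕ := ∑ v ∈ e, Finsupp.single v 1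

open Classical in
theorem edgeExponent_apply (e : Finset V) (v : V) : edgeExponent e v = if v ∈ e then 1 else 0 := by
  simp [edgeExponent, Finsupp.finsetSum_apply, Finsupp.single_apply]

theorem edgeExponent_eq_indicator (e : Finset V) (v : V) :
    (edgeExponent e v : ℝ) = Set.indicator (e : Set V) (1 : V → ℝ) v := by
  classical
  by_cases h : v ∈ e <;> simp [edgeExponent_apply, h]

theorem sum_edgeExponent_mul [Fintype V] (e : Finset V) (x : V → ℝ) :
    ∑ v, (edgeExponent e v : ℝ) * x v = ∑ v ∈ e, x v := by
  classical
  simp [edgeExponent_apply]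

variable (K : Type*) [Field K]

theorem prod_X_eq_monomial (e : Finset V) :
    ∏ v ∈ e, (MvPolynomial.X v : MvPolynomial V K) = MvPolynomial.monomial (edgeExponent e) 1 := by
  rw [edgeExponent, MvPolynomial.monomial_sum_one]
  rfl

theorem monomial_edgeExponent_mem (C : Clutter V) {e : Finset V} (he : e ∈ C.edges) :
    MvPolynomial.monomial (edgeExponent e) (1 : K) ∈ C.edgeIdeal K :=
  Ideal.subset_span ⟨e, he, (prod_X_eq_monomial K e).symm⟩

variable {K}

theorem mem_edgeIdeal {C : Clutter V} {f : MvPolynomial V K} :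
    f ∈ C.edgeIdeal K ↔ ∀ m ∈ f.support, ∃ e ∈ C.edges, edgeExponent e ≤ m := by
  have : C.edgeIdeal K = Ideal.span ((fun s => MvPolynomial.monomial s (1 : K)) ''
      (edgeExponent '' (C.edges : Set (Finset V)))) := by
    rw [edgeIdeal]
    congr 1
    ext f
    simp [prod_X_eq_monomial, eq_comm]
  rw [this, MvPolynomial.mem_ideal_span_monomial_image]
  simp

/-- Every monomial of an element of `I ^ r` has weight at least `r` with respect to a point of the
covering polyhedron. -/
theorem le_sum_of_mem_edgeIdeal_pow [Fintype V] {C : Clutter V} {x : V → ℝ}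
    (hx : x ∈ C.coveringPolyhedron) {r : ℕ} {f : MvPolynomial V K} (hf : f ∈ C.edgeIdeal K ^ r) :
    ∀ m ∈ f.support, (r : ℝ) ≤ ∑ v, (m v : ℝ) * x v := by
  classical
  rw [mem_coveringPolyhedron] at hx
  induction r generalizing f with
  | zero =>
    intro m _
    simpa using Finset.sum_nonneg fun v _ => mul_nonneg (Nat.cast_nonneg _) (hx.1 v)
  | succ r ih =>
    rw [pow_succ] at hf
    refine Submodule.mul_induction_on hf (fun g hg h hh m hm => ?_) (fun g h hg hh m hm => ?_)
    · obtain ⟨a, ha, b, hb, rfl⟩ := Finset.mem_add.1 (MvPolynomial.support_mul g h hm)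
      obtain ⟨e, he, heb⟩ := mem_edgeIdeal.1 hh b hb
      have h1 := ih hg a ha
      have h2 : (1 : ℝ) ≤ ∑ v, (b v : ℝ) * x v := by
        refine (hx.2 e he).trans ?_
        rw [← sum_edgeExponent_mul]
        exact Finset.sum_le_sum fun v _ =>
          mul_le_mul_of_nonneg_right (by exact_mod_cast heb v) (hx.1 v)
      push_cast [Finsupp.add_apply]
      simp only [add_mul, Finset.sum_add_distrib]
      linarith
    · rcases Finset.mem_union.1 (MvPolynomial.support_add hm) with h' | h'
      · exact hg m h'
      · exact hh m h'

/-! ### Monomial description of symbolic powers. -/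

theorem natCast_le_weightedOrder_iff {w : V → ℕ} {n : ℕ} {f : MvPolynomial V K} :
    (n : ℕ∞) ≤ (f : MvPowerSeries V K).weightedOrder w ↔
      ∀ m ∈ f.support, n ≤ Finsupp.weight w m := by
  constructor
  · intro h m hm
    have := h.trans (MvPowerSeries.weightedOrder_le w (f := (f : MvPowerSeries V K)) (d := m)
      (by simpa using hm))
    exact_mod_cast this
  · intro h
    refine MvPowerSeries.nat_le_weightedOrder w fun d hd => ?_
    by_contra hd'
    have := h d (by simpa using hd')
    omega

open Classical in
theorem weight_indicator (c : Finset V) (m : V →₀ ℕ) :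
    Finsupp.weight (fun v => if v ∈ c then 1 else 0) m = ∑ v ∈ c, m v := by
  simp only [Finsupp.weight_apply, Finsupp.sum, smul_eq_mul, mul_ite, mul_one, mul_zero]
  rw [← Finset.sum_filter]
  refine Finset.sum_subset_zero_on_sdiff (fun v hv => (Finset.mem_filter.1 hv).2) ?_ (by simp)
  intro v hv
  simp only [Finset.mem_sdiff, Finset.mem_filter, Finsupp.mem_support_iff] at hv
  tauto

theorem mem_span_X_iff {c : Finset V} {f : MvPolynomial V K} :
    f ∈ Ideal.span (MvPolynomial.X '' (c : Set V) : Set (MvPolynomial V K)) ↔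
      ∀ m ∈ f.support, 1 ≤ ∑ v ∈ c, m v := by
  rw [MvPolynomial.mem_ideal_span_X_image]
  refine forall₂_congr fun m _ => ?_
  rw [Nat.one_le_iff_ne_zero, Ne, Finset.sum_eq_zero_iff]
  push Not
  simp

/-- The ideal consists of the `f` whose order in the variables of `c` is nonzero, and this order is
additive on products. Polynomials are viewed as power series to use
`MvPowerSeries.weightedOrder_mul`. -/
theorem isPrime_span_X (c : Finset V) :
    (Ideal.span (MvPolynomial.X '' (c : Set V) : Set (MvPolynomial V K))).IsPrime := by
  classical
  have key : ∀ f : MvPolynomial V K,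
      f ∈ Ideal.span (MvPolynomial.X '' (c : Set V) : Set (MvPolynomial V K)) ↔
      (f : MvPowerSeries V K).weightedOrder (fun v => if v ∈ c then 1 else 0) ≠ 0 := by
    intro f
    rw [mem_span_X_iff, ← Order.one_le_iff_ne_zero, ← Nat.cast_one (R := ℕ∞), natCast_le_weightedOrder_iff]
    simp only [weight_indicator]
  refine ⟨(Ideal.ne_top_iff_one _).2 ?_, fun {f g} h => ?_⟩
  · rw [key]
    simp
  · simp only [key, MvPolynomial.coe_mul, MvPowerSeries.weightedOrder_mul] at h ⊢
    by_contra! h'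
    simp [h'.1, h'.2] at h

theorem IsCover.edgeIdeal_le {C : Clutter V} {c : Finset V} (hc : C.IsCover c) :
    C.edgeIdeal K ≤ Ideal.span (MvPolynomial.X '' (c : Set V)) := by
  classical
  intro f hf
  rw [MvPolynomial.mem_ideal_span_X_image]
  intro m hm
  obtain ⟨e, he, hem⟩ := mem_edgeIdeal.1 hf m hm
  obtain ⟨v, hv, hvc⟩ := hc e he
  refine ⟨v, hvc, ?_⟩
  have := hem v
  rw [edgeExponent_apply, if_pos hv] at this
  omega

/-- If no edge divides a monomial of `f`, the variables absent from it form a cover. The prime they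
generate contains `f ^ k`, hence `f`, so the monomial would involve an absent variable. -/
theorem edgeIdeal_isRadical [Fintype V] (C : Clutter V) : (C.edgeIdeal K).IsRadical := by
  classical
  rintro f ⟨k, hk⟩
  rw [mem_edgeIdeal]
  intro m hm
  by_contra! h
  have hc : C.IsCover (Finset.univ.filter fun v => m v = 0) := by
    intro e he
    by_contra! hv
    refine h e he fun v => ?_
    rw [edgeExponent_apply]
    split_ifs with hve
    · exact Nat.one_le_iff_ne_zero.2 (by simpa using hv v hve)
    · exact Nat.zero_le _
  have := (isPrime_span_X (K := K) _).mem_of_pow_mem k (hc.edgeIdeal_le hk)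
  obtain ⟨v, hv, hv'⟩ := MvPolynomial.mem_ideal_span_X_image.1 this m hm
  simp at hv
  exact hv' hv

open Classical in
/-- The variables in a prime ideal containing the edge ideal form a vertex cover. -/
theorem isCover_of_le [Fintype V] {C : Clutter V} {p : Ideal (MvPolynomial V K)} [hp : p.IsPrime]
    (h : C.edgeIdeal K ≤ p) :
    C.IsCover (Finset.univ.filter fun v => (MvPolynomial.X v : MvPolynomial V K) ∈ p) := by
  intro e he
  have : ∏ v ∈ e, (MvPolynomial.X v : MvPolynomial V K) ∈ p := h (Ideal.subset_span ⟨e, he, rfl⟩)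
  obtain ⟨v, hv, hvp⟩ := hp.prod_mem_iff.1 this
  exact ⟨v, hv, by simpa using hvp⟩

/-- Every monomial of an element of the symbolic power `I^{(n)}` has degree at least `n` in the
variables of any vertex cover. -/
theorem le_sum_of_mem_symbolicPower [Fintype V] {C : Clutter V} {c : Finset V} (hc : C.IsCover c)
    {n : ℕ} {f : MvPolynomial V K} (hf : f ∈ symbolicPower (C.edgeIdeal K) n) :
    ∀ m ∈ f.support, n ≤ ∑ v ∈ c, m v := by
  classical
  have := isPrime_span_X (K := K) c
  obtain ⟨p, hp, hpc⟩ := Ideal.exists_minimalPrimes_le (hc.edgeIdeal_le (K := K))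
  have hpp : p.IsPrime := hp.1.1
  have hass : p ∈ associatedPrimes (MvPolynomial V K) (MvPolynomial V K ⧸ C.edgeIdeal K) := by
    apply Module.associatedPrimes.minimalPrimes_annihilator_subset_associatedPrimes
    rwa [Ideal.annihilator_quotient]
  obtain ⟨u, hu, huf⟩ := mem_symbolicPower.1 hf p hass
  -- The variables in the minimal prime `p` form a cover inside `c`, so it suffices to bound the
  -- degree in `d`. There `u ∉ p` has order zero, so `u * f` and `f` have the same order.
  set d := Finset.univ.filter fun v => (MvPolynomial.X v : MvPolynomial V K) ∈ p with hd
  have hdc : d ⊆ c := by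
    intro v hv
    have hv' := hpc (by simpa [hd] using hv)
    obtain ⟨i, hi, hi'⟩ := MvPolynomial.mem_ideal_span_X_image.1 hv' (Finsupp.single v 1)
      (by simp [MvPolynomial.mem_support_iff, MvPolynomial.X])
    by_cases hiv : v = i
    · exact hiv ▸ hi
    · simp [hiv] at hi'
  have hdp : Ideal.span (MvPolynomial.X '' (d : Set V)) ≤ p := by
    rw [Ideal.span_le]
    rintro _ ⟨v, hv, rfl⟩
    simpa [hd] using hv
  have hud : ¬ ∀ m ∈ u.support, 1 ≤ ∑ v ∈ d, m v := fun h => hu (hdp (mem_span_X_iff.2 h))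
  have h0 : (u : MvPowerSeries V K).weightedOrder (fun v => if v ∈ d then 1 else 0) = 0 := by
    by_contra h0
    rw [← Ne, ← Order.one_le_iff_ne_zero, ← Nat.cast_one (R := ℕ∞), natCast_le_weightedOrder_iff] at h0
    simp only [weight_indicator] at h0
    exact hud h0
  have hdcov : C.IsCover d := isCover_of_le hp.1.2
  have h1 : (n : ℕ∞) ≤ ((u * f : MvPolynomial V K) : MvPowerSeries V K).weightedOrder
      (fun v => if v ∈ d then 1 else 0) := by
    rw [natCast_le_weightedOrder_iff]
    intro m hm
    have := le_sum_of_mem_edgeIdeal_pow (indicator_mem_coveringPolyhedron.2 hdcov) huf m hm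
    rw [weight_indicator]
    simp only [Set.indicator_apply, Finset.mem_coe, Pi.one_apply, mul_ite, mul_one, mul_zero,
      Finset.sum_ite_mem, Finset.univ_inter] at this
    exact_mod_cast this
  rw [MvPolynomial.coe_mul, MvPowerSeries.weightedOrder_mul, h0, zero_add,
    natCast_le_weightedOrder_iff] at h1
  intro m hm
  have := h1 m hm
  rw [weight_indicator] at this
  exact this.trans (Finset.sum_le_sum_of_subset hdc)

/-- A monomial of degree at least `n` in the variables of every vertex cover lies in `I^{(n)}`. -/
theorem monomial_mem_symbolicPower [Fintype V] {C : Clutter V} {n : ℕ} {m : V →₀ ℕ}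
    (hm : ∀ c, C.IsCover c → n ≤ ∑ v ∈ c, m v) (k : K) :
    MvPolynomial.monomial m k ∈ symbolicPower (C.edgeIdeal K) n := by
  classical
  rw [mem_symbolicPower]
  intro p hp
  have hpp : p.IsPrime := hp.1
  obtain ⟨-, x, hx⟩ := isAssociatedPrime_iff.1 hp
  obtain ⟨f, rfl⟩ := Ideal.Quotient.mk_surjective x
  have hmem : ∀ g, g ∈ p ↔ g * f ∈ C.edgeIdeal K := by
    intro g
    rw [hx, Submodule.mem_colon_singleton, Submodule.mem_bot, ← Ideal.Quotient.eq_zero_iff_mem]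
    rfl
  -- Here `p` is the annihilator of the class of `f`; if `f ∈ p`, then `f ^ 2` and, by radicality,
  -- `f` would lie in the edge ideal.
  have hfp : f ∉ p := by
    intro hf
    have h1 : f ∈ C.edgeIdeal K := edgeIdeal_isRadical C ⟨2, by simpa [sq] using (hmem f).1 hf⟩
    exact hpp.ne_top ((Ideal.eq_top_iff_one p).2 ((hmem 1).2 (by simpa using h1)))
  have hle : C.edgeIdeal K ≤ p := fun g hg => (hmem g).2 (Ideal.mul_mem_right _ _ hg)
  set c := Finset.univ.filter fun v => (MvPolynomial.X v : MvPolynomial V K) ∈ p with hc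
  have hcov : C.IsCover c := isCover_of_le hle
  -- One factor `f` for each variable of `c` in the monomial, counted with multiplicity: each
  -- product `X v * f` lies in the edge ideal.
  refine ⟨f ^ (∑ v ∈ c, m v), fun h => hfp (hpp.mem_of_pow_mem _ h), ?_⟩
  apply Ideal.pow_le_pow_right (hm c hcov)
  have hprod : ∏ v ∈ c, (MvPolynomial.X v * f : MvPolynomial V K) ^ m v ∈
      C.edgeIdeal K ^ (∑ v ∈ c, m v) := by
    rw [← Finset.prod_pow_eq_pow_sum]
    refine Ideal.prod_mem_prod fun v hv => Ideal.pow_mem_pow ((hmem _).1 ?_) _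
    simpa [hc] using hv
  have heq : f ^ (∑ v ∈ c, m v) * MvPolynomial.monomial m k =
      (∏ v ∈ c, (MvPolynomial.X v * f : MvPolynomial V K) ^ m v) *
        (MvPolynomial.C k * ∏ v ∈ cᶜ, MvPolynomial.X v ^ m v) := by
    rw [MvPolynomial.monomial_eq, Finsupp.prod_fintype _ _ (by simp), ← Finset.prod_mul_prod_compl c]
    simp only [mul_pow, Finset.prod_mul_distrib, Finset.prod_pow_eq_pow_sum]
    ring
  rw [heq]
  exact Ideal.mul_mem_right _ _ hprod

end Clutter

/-! ### Separation by a nonnegative weight. -/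

open scoped Pointwise in
/-- A point outside the Minkowski sum of the convex hull of a finite set and the nonnegative orthant
is separated from that set by a nonnegative weight. -/
theorem exists_nonneg_separating_weight {V : Type*} [Fintype V] {F : Set (V → ℝ)} (hF : F.Finite)
    (hne : F.Nonempty) {x : V → ℝ} (hx : ¬ ∃ y ∈ convexHull ℝ F, y ≤ x) :
    ∃ (a : V → ℝ) (u : ℝ), (∀ v, 0 ≤ a v) ∧ ∑ v, a v * x v < u ∧
      ∀ y ∈ F, u < ∑ v, a v * y v := by
  classical
  set M : Set (V → ℝ) := convexHull ℝ F + Set.Ici (0 : V → ℝ) with hM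
  have hMc : Convex ℝ M := (convex_convexHull ℝ F).add (convex_Ici 0)
  have hMcl : IsClosed M := isClosed_Ici.add_left_of_isCompact (hF.isCompact_convexHull ℝ)
  have hxM : x ∉ M := by
    rintro ⟨y, hy, z, hz, rfl⟩
    exact hx ⟨y, hy, le_add_of_nonneg_right hz⟩
  obtain ⟨f, u, hfx, hfM⟩ := geometric_hahn_banach_point_closed hMc hMcl hxM
  have hf : ∀ y : V → ℝ, f y = ∑ v, f (Pi.single v 1) * y v := by
    intro y
    conv_lhs => rw [← Finset.univ_sum_single y]
    rw [map_sum]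
    refine Finset.sum_congr rfl fun v _ => ?_
    rw [show (Pi.single v (y v) : V → ℝ) = y v • Pi.single v 1 by
      rw [← Pi.single_smul, smul_eq_mul, mul_one], map_smul, smul_eq_mul, mul_comm]
  refine ⟨fun v => f (Pi.single v 1), u, fun v => ?_, by rw [← hf]; exact hfx, fun y hy => ?_⟩
  · obtain ⟨y, hy⟩ := hne
    by_contra! hneg
    -- The step along a coordinate with negative coefficient is chosen so that `f` takes exactly the
    -- value `u`, against the strict inequality on `M`.
    have h := hfM (y + ((f y - u) / (-f (Pi.single v 1))) • Pi.single v 1)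
      ⟨y, subset_convexHull ℝ F hy, _, ?_, rfl⟩
    · rw [map_add, map_smul, smul_eq_mul] at h
      have : (f y - u) / (-f (Pi.single v 1)) * f (Pi.single v 1) = -(f y - u) := by
        field_simp [hneg.ne]
      rw [this] at h
      linarith
    · have hyu := hfM y ⟨y, subset_convexHull ℝ F hy, 0, Set.mem_Ici.2 le_rfl, add_zero y⟩
      exact Set.mem_Ici.2 (smul_nonneg (div_nonneg (by linarith) (by linarith))
        (Pi.single_nonneg.2 zero_le_one))
  · rw [← hf]
    exact hfM y ⟨y, subset_convexHull ℝ F hy, 0, Set.mem_Ici.2 le_rfl, add_zero y⟩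

/-! ### Linear programming on the covering polyhedron. -/

namespace Clutter

variable {V : Type*} [Fintype V] {C : Clutter V}

theorem isClosed_coveringPolyhedron : IsClosed C.coveringPolyhedron := by
  have : C.coveringPolyhedron = (⋂ v, {x : V → ℝ | 0 ≤ x v}) ∩
      ⋂ e ∈ C.edges, {x : V → ℝ | 1 ≤ ∑ v ∈ e, x v} := by
    ext x
    simp [mem_coveringPolyhedron]
  rw [this]
  exact (isClosed_iInter fun v => isClosed_le (by fun_prop) (by fun_prop)).inter
    (isClosed_biInter fun e _ => isClosed_le (by fun_prop) (by fun_prop))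

/-- Truncation reduces minimisation over the unbounded polyhedron to the compact unit cube. -/
theorem inf_one_mem_coveringPolyhedron {x : V → ℝ} (hx : x ∈ C.coveringPolyhedron) :
    x ⊓ 1 ∈ C.coveringPolyhedron := by
  rw [mem_coveringPolyhedron] at hx ⊢
  have h0 : ∀ v, 0 ≤ (x ⊓ 1) v := fun v => le_inf (hx.1 v) zero_le_one
  refine ⟨h0, fun e he => ?_⟩
  by_cases h : ∃ v ∈ e, 1 ≤ x v
  · obtain ⟨v, hv, hxv⟩ := h
    calc (1 : ℝ) = (x ⊓ 1) v := by simp [hxv]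
      _ ≤ _ := Finset.single_le_sum (fun i _ => h0 i) hv
  · push Not at h
    refine (hx.2 e he).trans_eq (Finset.sum_congr rfl fun v hv => ?_)
    simp [(h v hv).le]

theorem coveringPolyhedron_upper {x y : V → ℝ} (hx : x ∈ C.coveringPolyhedron) (hxy : x ≤ y) :
    y ∈ C.coveringPolyhedron := by
  rw [mem_coveringPolyhedron] at hx ⊢
  exact ⟨fun v => (hx.1 v).trans (hxy v),
    fun e he => (hx.2 e he).trans (Finset.sum_le_sum fun v _ => hxy v)⟩

/-- A strictly positive weight is minimised on the covering polyhedron at a vertex, and this vertex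
lies in the unit cube. -/
theorem exists_extremePoint_minimizing {a : V → ℝ} (ha : ∀ v, 0 < a v)
    (hne : C.coveringPolyhedron.Nonempty) :
    ∃ y ∈ C.coveringPolyhedron.extremePoints ℝ, y ≤ 1 ∧
      ∀ x ∈ C.coveringPolyhedron, ∑ v, a v * y v ≤ ∑ v, a v * x v := by
  classical
  set Q := C.coveringPolyhedron with hQ
  set φ : (V → ℝ) →L[ℝ] ℝ := ∑ v, a v • ContinuousLinearMap.proj v with hφ
  have hφa : ∀ x, φ x = ∑ v, a v * x v := fun x => by simp [hφ]
  have hcube : IsCompact (Q ∩ Set.Icc 0 1) := isCompact_Icc.inter_left isClosed_coveringPolyhedron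
  obtain ⟨x₀, hx₀⟩ := hne
  have hmono : ∀ x y : V → ℝ, x ≤ y → φ x ≤ φ y := fun x y h => by
    rw [hφa, hφa]
    exact Finset.sum_le_sum fun v _ => mul_le_mul_of_nonneg_left (h v) (ha v).le
  have hinf : ∀ x ∈ Q, x ⊓ 1 ∈ Q ∩ Set.Icc 0 1 := fun x hx =>
    ⟨inf_one_mem_coveringPolyhedron hx,
      fun v => (mem_coveringPolyhedron.1 (inf_one_mem_coveringPolyhedron hx)).1 v, inf_le_right⟩
  obtain ⟨z, hz, hzmin⟩ := hcube.exists_isMinOn ⟨_, hinf _ hx₀⟩ φ.continuous.continuousOn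
  have hzQ : ∀ x ∈ Q, φ z ≤ φ x := fun x hx =>
    (hzmin (hinf x hx)).trans (hmono _ _ inf_le_left)
  -- The face of minimisers. As `a` is strictly positive, truncating at `1` strictly improves any
  -- point outside the cube, so `B` is compact and has an extreme point; `B` being exposed, that
  -- point is a vertex of `Q`.
  set B := {x ∈ Q | ∀ y ∈ Q, (-φ) y ≤ (-φ) x} with hB
  have hexp : IsExposed ℝ Q B := fun _ => ⟨-φ, rfl⟩
  have hBle : ∀ x ∈ B, x ≤ 1 := by
    intro x hx v
    by_contra! hv
    have h1 := hx.2 _ (hinf x hx.1).1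
    have h2 : φ (x ⊓ 1) < φ x := by
      rw [hφa, hφa]
      refine Finset.sum_lt_sum (fun w _ => mul_le_mul_of_nonneg_left inf_le_left (ha w).le)
        ⟨v, Finset.mem_univ v, mul_lt_mul_of_pos_left ?_ (ha v)⟩
      simpa using hv
    simp only [neg_apply, neg_le_neg_iff] at h1
    linarith
  have hBc : IsCompact B := by
    refine isCompact_Icc.of_isClosed_subset (hexp.isClosed isClosed_coveringPolyhedron)
      (fun x hx => ⟨fun v => (mem_coveringPolyhedron.1 hx.1).1 v, hBle x hx⟩)
  have hzB : z ∈ B := ⟨hz.1, fun y hy => by simpa using hzQ y hy⟩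
  obtain ⟨y, hy⟩ := hBc.extremePoints_nonempty ⟨z, hzB⟩
  refine ⟨y, hexp.isExtreme.extremePoints_subset_extremePoints hy, hBle y hy.1, fun x hx => ?_⟩
  have := hy.1.2 x hx
  simpa [hφa] using this

/-- If the covering polyhedron is integral, then a nonnegative weight that is at least `n` on all
vertex covers is at least `n` on the covering polyhedron. -/
theorem le_sum_of_isIntegralPolyhedron (hint : IsIntegralPolyhedron C.coveringPolyhedron)
    {a : V → ℝ} (ha : ∀ v, 0 ≤ a v) {n : ℝ} (hn : ∀ c, C.IsCover c → n ≤ ∑ v ∈ c, a v)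
    {x : V → ℝ} (hx : x ∈ C.coveringPolyhedron) : n ≤ ∑ v, a v * x v := by
  classical
  have hx0 := (mem_coveringPolyhedron.1 hx).1
  -- The perturbation makes the weight strictly positive, as the existence of a minimising vertex
  -- requires; `ε` then tends to zero.
  have key : ∀ ε : ℝ, 0 < ε → n ≤ ∑ v, a v * x v + ε * ∑ v, x v := by
    intro ε hε
    obtain ⟨y, hy, hy1, hmin⟩ := exists_extremePoint_minimizing (C := C) (a := fun v => a v + ε)
      (fun v => add_pos_of_nonneg_of_pos (ha v) hε) ⟨x, hx⟩
    have hy0 := (mem_coveringPolyhedron.1 hy.1).1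
    set c := Finset.univ.filter fun v => y v = 1 with hc
    have hyc : y = Set.indicator (c : Set V) 1 := by
      funext v
      obtain ⟨k, hk⟩ := hint y hy v
      have h0 : (0 : ℝ) ≤ k := hk ▸ hy0 v
      have h1 : (k : ℝ) ≤ 1 := hk ▸ hy1 v
      have h0' : 0 ≤ k := by exact_mod_cast h0
      have h1' : k ≤ 1 := by exact_mod_cast h1
      by_cases hv : y v = 1
      · simp [hc, hv]
      · have : k = 0 := by
          by_contra hk0
          exact hv (by rw [hk, show k = 1 by omega]; simp)
        simp [hc, hk, this]
    have hcov : C.IsCover c := indicator_mem_coveringPolyhedron.1 (hyc ▸ hy.1)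
    calc n ≤ ∑ v ∈ c, a v := hn c hcov
      _ = ∑ v, a v * y v := by
        rw [hyc]
        simp [Set.indicator_apply]
      _ ≤ ∑ v, (a v + ε) * y v := Finset.sum_le_sum fun v _ =>
        mul_le_mul_of_nonneg_right (by linarith) (hy0 v)
      _ ≤ ∑ v, (a v + ε) * x v := hmin x hx
      _ = _ := by simp only [add_mul, Finset.sum_add_distrib, Finset.mul_sum]
  have hs : 0 ≤ ∑ v, x v := Finset.sum_nonneg fun v _ => hx0 v
  refine le_of_forall_pos_le_add fun δ hδ => (key (δ / (∑ v, x v + 1)) (by positivity)).trans ?_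
  gcongr
  rw [div_mul_eq_mul_div, div_le_iff₀ (by positivity)]
  nlinarith

/-- A weight that is at least `1` on the covering polyhedron dominates a convex combination of
characteristic vectors of edges. -/
theorem exists_mem_convexHull_edges (hne : C.edges.Nonempty) {a : V → ℝ}
    (ha0 : ∀ v, 0 ≤ a v) (ha : ∀ x ∈ C.coveringPolyhedron, 1 ≤ ∑ v, a v * x v) :
    ∃ y ∈ convexHull ℝ ((fun e : Finset V => Set.indicator (e : Set V) (1 : V → ℝ)) '' C.edges),
      y ≤ a := by
  classical
  by_contra h
  obtain ⟨x, u, hx0, hxa, hxe⟩ := exists_nonneg_separating_weight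
    (C.edges.finite_toSet.image _) ((Finset.coe_nonempty.2 hne).image _) h
  have hxe' : ∀ e ∈ C.edges, u < ∑ v ∈ e, x v := fun e he => by
    simpa [Set.indicator_apply] using hxe _ ⟨e, he, rfl⟩
  rcases le_or_gt u 0 with hu | hu
  · have := Finset.sum_nonneg fun v (_ : v ∈ Finset.univ) => mul_nonneg (hx0 v) (ha0 v)
    linarith
  -- Rescaling the separating weight gives a point of the covering polyhedron on which `a` has value
  -- less than `1`.
  · have hmem : (fun v => x v / u) ∈ C.coveringPolyhedron := by
      rw [mem_coveringPolyhedron]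
      refine ⟨fun v => div_nonneg (hx0 v) hu.le, fun e he => ?_⟩
      rw [← Finset.sum_div, le_div_iff₀ hu, one_mul]
      exact (hxe' e he).le
    have := ha _ hmem
    simp only [mul_div_assoc', ← Finset.sum_div] at this
    rw [le_div_iff₀ hu, one_mul] at this
    simp only [mul_comm (a _)] at this
    linarith

end Clutter

/-! ### Splitting off an edge, and the criterion for integrality. -/

namespace Clutter

variable {V : Type*} [Fintype V] {C : Clutter V}

/-- If the exponent `m` has weight at least `n > |V|` on the covering polyhedron, then an edge can
be split off from `m`. -/
theorem exists_edgeExponent_le (hne : C.edges.Nonempty) {n : ℕ} (hn : Fintype.card V + 1 ≤ n)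
    {m : V →₀ ℕ} (hm : ∀ x ∈ C.coveringPolyhedron, (n : ℝ) ≤ ∑ v, (m v : ℝ) * x v) :
    ∃ e ∈ C.edges, edgeExponent e ≤ m ∧
      ∀ x ∈ C.coveringPolyhedron, (n : ℝ) - 1 ≤ ∑ v, ((m - edgeExponent e) v : ℝ) * x v := by
  classical
  have hn0 : (0 : ℝ) < n := by exact_mod_cast (by omega : 0 < n)
  obtain ⟨y, hy, hym⟩ := exists_mem_convexHull_edges hne (a := fun v => (m v : ℝ) / n)
    (fun v => by positivity) (fun x hx => by
      simp only [div_mul_eq_mul_div, ← Finset.sum_div]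
      rw [le_div_iff₀ hn0, one_mul]
      exact hm x hx)
  -- Carathéodory: affine independence leaves at most `|V| + 1 ≤ n` edges. The numbers `n * w j` sum
  -- to `n`, so one of them is at least `1`.
  obtain ⟨ι, _, z, w, hz, hind, hw, hw1, rfl⟩ := eq_pos_convex_span_of_mem_convexHull hy
  have hcard : Fintype.card ι ≤ n := by
    refine (hind.card_le_finrank_succ.trans ?_).trans hn
    gcongr
    exact (Submodule.finrank_le _).trans_eq (Module.finrank_fintype_fun_eq_card ℝ)
  obtain ⟨i, hi⟩ : ∃ i, 1 ≤ (n : ℝ) * w i := by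
    by_contra! h
    have hιne : (Finset.univ : Finset ι).Nonempty := by
      by_contra h'
      rw [Finset.not_nonempty_iff_eq_empty] at h'
      simp [h'] at hw1
    have := Finset.sum_lt_sum_of_nonempty hιne fun j _ => h j
    rw [← Finset.mul_sum, hw1] at this
    simp only [mul_one, Finset.sum_const, Finset.card_univ, nsmul_eq_mul] at this
    exact absurd (Nat.cast_lt.1 this) (by omega)
  choose E hE hEz using fun j => hz (Set.mem_range_self j)
  have hzE : ∀ j v, z j v = (edgeExponent (E j) v : ℝ) := fun j v => by
    rw [edgeExponent_eq_indicator, ← hEz]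
  have hym' : ∀ v, ∑ j, (n * w j) * (edgeExponent (E j) v : ℝ) ≤ m v := by
    intro v
    have := hym v
    simp only [Finset.sum_apply, Pi.smul_apply, smul_eq_mul, hzE] at this
    rw [le_div_iff₀ hn0, mul_comm, Finset.mul_sum] at this
    simpa only [mul_assoc] using this
  -- The coefficients left after removing edge `E i` once: nonnegative, of sum `n - 1`, with
  -- combination still below `m - edgeExponent (E i)`.
  set q : ι → ℝ := fun j => n * w j - if j = i then 1 else 0 with hq
  have hq0 : ∀ j, 0 ≤ q j := by
    intro j
    by_cases hj : j = i
    · subst hj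
      simpa [hq] using hi
    · simpa [hq, hj] using mul_nonneg hn0.le (hw j).le
  have hqsum : ∑ j, q j = n - 1 := by
    simp [hq, Finset.sum_sub_distrib, ← Finset.mul_sum, hw1]
  have hqm : ∀ v, ∑ j, q j * (edgeExponent (E j) v : ℝ) ≤ m v - edgeExponent (E i) v := by
    intro v
    simp only [hq, sub_mul, Finset.sum_sub_distrib, ite_mul, one_mul, zero_mul,
      Finset.sum_ite_eq', Finset.mem_univ, if_true]
    linarith [hym' v]
  have hle : edgeExponent (E i) ≤ m := by
    intro v
    have h := (Finset.sum_nonneg fun j (_ : j ∈ Finset.univ) =>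
      mul_nonneg (hq0 j) (Nat.cast_nonneg (α := ℝ) (edgeExponent (E j) v))).trans (hqm v)
    exact_mod_cast sub_nonneg.1 h
  refine ⟨E i, hE i, hle, fun x hx => ?_⟩
  have hx' := mem_coveringPolyhedron.1 hx
  calc (n : ℝ) - 1 = ∑ j, q j * 1 := by simp [hqsum]
    _ ≤ ∑ j, q j * ∑ v, (edgeExponent (E j) v : ℝ) * x v := by
      refine Finset.sum_le_sum fun j _ => mul_le_mul_of_nonneg_left ?_ (hq0 j)
      rw [sum_edgeExponent_mul]
      exact hx'.2 _ (hE j)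
    _ = ∑ v, (∑ j, q j * (edgeExponent (E j) v : ℝ)) * x v := by
      simp only [Finset.mul_sum, Finset.sum_mul, mul_assoc]
      exact Finset.sum_comm
    _ ≤ _ := by
      refine Finset.sum_le_sum fun v _ => mul_le_mul_of_nonneg_right ?_ (hx'.1 v)
      rw [Finsupp.tsub_apply, Nat.cast_sub (hle v)]
      exact hqm v

variable {K : Type*} [Field K]

theorem le_sum_cover_of_forall_le {n : ℕ} {m : V →₀ ℕ}
    (hm : ∀ x ∈ C.coveringPolyhedron, (n : ℝ) ≤ ∑ v, (m v : ℝ) * x v) (c : Finset V)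
    (hc : C.IsCover c) : n ≤ ∑ v ∈ c, m v := by
  classical
  have := hm _ (indicator_mem_coveringPolyhedron.2 hc)
  simp only [Set.indicator_apply, Finset.mem_coe, Pi.one_apply, mul_ite, mul_one, mul_zero,
    Finset.sum_ite_mem, Finset.univ_inter] at this
  exact_mod_cast this

/-- If the covering polyhedron is integral, then the containments `I^{(r + 1)} ⊆ I ^ r` for
`r < |V|` imply those for all `r`. -/
theorem symbolicPower_succ_le (hne : C.edges.Nonempty)
    (hint : IsIntegralPolyhedron C.coveringPolyhedron)
    (h : ∀ r, 1 ≤ r → r ≤ Fintype.card V - 1 →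
      symbolicPower (C.edgeIdeal K) (r + 1) ≤ C.edgeIdeal K ^ r) (r : ℕ) :
    symbolicPower (C.edgeIdeal K) (r + 1) ≤ C.edgeIdeal K ^ r := by
  induction r with
  | zero => simp
  | succ r ih =>
    -- Beyond this range `r + 2 ≥ |V| + 1`, exactly what splitting off an edge needs.
    by_cases hr : r + 1 ≤ Fintype.card V - 1
    · exact h _ (by omega) hr
    intro f hf
    rw [f.as_sum]
    refine Ideal.sum_mem _ fun m hm => ?_
    have hcov : ∀ x ∈ C.coveringPolyhedron, ((r + 1 + 1 : ℕ) : ℝ) ≤ ∑ v, (m v : ℝ) * x v := by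
      intro x hx
      refine le_sum_of_isIntegralPolyhedron hint (fun v => Nat.cast_nonneg _) (fun c hc => ?_) hx
      exact_mod_cast le_sum_of_mem_symbolicPower hc hf m hm
    obtain ⟨e, he, hem, hsub⟩ := exists_edgeExponent_le hne (by omega) hcov
    have h1 : MvPolynomial.monomial (m - edgeExponent e) (f.coeff m) ∈ C.edgeIdeal K ^ r := by
      refine ih (monomial_mem_symbolicPower (le_sum_cover_of_forall_le fun x hx => ?_) _)
      have := hsub x hx
      push_cast at this ⊢
      linarith
    have h2 := Ideal.mul_mem_mul h1 (monomial_edgeExponent_mem K C he)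
    rwa [MvPolynomial.monomial_mul, tsub_add_cancel_of_le hem, mul_one, ← pow_succ] at h2

/-- If `I^{(n)} ⊆ I ^ r` for all `n > r ≥ 1`, then the covering polyhedron is integral. -/
theorem isIntegralPolyhedron_of_symbolicPower_le (hempty : ∅ ∉ C.edges)
    (h : ∀ n r, 1 ≤ r → r < n → symbolicPower (C.edgeIdeal K) n ≤ C.edgeIdeal K ^ r) :
    IsIntegralPolyhedron C.coveringPolyhedron := by
  classical
  intro x hx
  have hx0 := (mem_coveringPolyhedron.1 hx.1).1
  set F : Set (V → ℝ) :=
    (fun c : Finset V => Set.indicator (c : Set V) (1 : V → ℝ)) '' {c | C.IsCover c} with hF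
  have huniv : C.IsCover Finset.univ := by
    intro e he
    obtain ⟨v, hv⟩ := Finset.nonempty_iff_ne_empty.2 fun h0 : e = ∅ => hempty (h0 ▸ he)
    exact ⟨v, hv, Finset.mem_univ v⟩
  have hFQ : F ⊆ C.coveringPolyhedron := by
    rintro _ ⟨c, hc, rfl⟩
    exact indicator_mem_coveringPolyhedron.2 hc
  have hconv : Convex ℝ C.coveringPolyhedron := by
    intro y hy z hz a b ha hb hab
    rw [mem_coveringPolyhedron] at hy hz ⊢
    refine ⟨fun v => add_nonneg (mul_nonneg ha (hy.1 v)) (mul_nonneg hb (hz.1 v)), fun e he => ?_⟩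
    simp only [Pi.add_apply, Pi.smul_apply, smul_eq_mul, Finset.sum_add_distrib, ← Finset.mul_sum]
    nlinarith [hy.2 e he, hz.2 e he]
  have hhull : convexHull ℝ F ⊆ C.coveringPolyhedron := convexHull_min hFQ hconv
  have hdom : ∃ y ∈ convexHull ℝ F, y ≤ x := by
    by_contra hno
    obtain ⟨a, u, ha0, hax, haF⟩ :=
      exists_nonneg_separating_weight (Set.toFinite F) ⟨_, _, huniv, rfl⟩ hno
    have hac : ∀ c, C.IsCover c → u < ∑ v ∈ c, a v := fun c hc => by
      simpa [Set.indicator_apply] using haF _ ⟨c, hc, rfl⟩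
    have hax0 : 0 ≤ ∑ v, a v * x v := Finset.sum_nonneg fun v _ => mul_nonneg (ha0 v) (hx0 v)
    -- approximate the weight `a` by an integral weight
    obtain ⟨N, hN⟩ := exists_nat_gt ((∑ v, x v) / (u - ∑ v, a v * x v))
    rw [div_lt_iff₀ (by linarith)] at hN
    set b : V →₀ ℕ := Finsupp.equivFunOnFinite.symm fun v => ⌈N * a v⌉₊ with hb
    have hbv : ∀ v, b v = ⌈N * a v⌉₊ := fun v => rfl
    set n := ⌈N * u⌉₊ with hn
    have hbc : ∀ c, C.IsCover c → n ≤ ∑ v ∈ c, b v := by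
      intro c hc
      rw [hn, Nat.ceil_le]
      push_cast
      calc N * u ≤ N * ∑ v ∈ c, a v := mul_le_mul_of_nonneg_left (hac c hc).le (Nat.cast_nonneg N)
        _ = ∑ v ∈ c, N * a v := Finset.mul_sum ..
        _ ≤ _ := Finset.sum_le_sum fun v _ => hbv v ▸ Nat.le_ceil _
    have hbx : ∑ v, (b v : ℝ) * x v < n := by
      calc ∑ v, (b v : ℝ) * x v ≤ ∑ v, (N * a v + 1) * x v :=
            Finset.sum_le_sum fun v _ => mul_le_mul_of_nonneg_right
              (hbv v ▸ (Nat.ceil_lt_add_one (mul_nonneg (Nat.cast_nonneg N) (ha0 v))).le) (hx0 v)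
        _ = N * ∑ v, a v * x v + ∑ v, x v := by
          simp only [add_mul, Finset.sum_add_distrib, one_mul, Finset.mul_sum, mul_assoc]
        _ < N * u := by linarith
        _ ≤ n := Nat.le_ceil _
    have hbx0 : 0 ≤ ∑ v, (b v : ℝ) * x v :=
      Finset.sum_nonneg fun v _ => mul_nonneg (Nat.cast_nonneg _) (hx0 v)
    -- Scaling by `k` widens the gap beyond `1`, so `k • b` has weight below `k * n - 1` at `x`
    -- although its monomial lies in `I^{(kn)}`.
    obtain ⟨k, hk⟩ := exists_nat_gt (1 / (n - ∑ v, (b v : ℝ) * x v))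
    have hgap : 0 < n - ∑ v, (b v : ℝ) * x v := by linarith
    rw [div_lt_iff₀ hgap] at hk
    have hkn : 1 ≤ k * n := by
      have hk0 : k ≠ 0 := by
        rintro rfl
        norm_num at hk
      have hn0 : n ≠ 0 := by
        intro hn0
        rw [hn0] at hbx
        norm_num at hbx
        linarith
      exact Nat.one_le_iff_ne_zero.2 (mul_ne_zero hk0 hn0)
    have hle : ((k * n - 1 : ℕ) : ℝ) ≤ k * ∑ v, (b v : ℝ) * x v := by
      rcases Nat.eq_zero_or_pos (k * n - 1) with h0 | h0
      · rw [h0, Nat.cast_zero]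
        exact mul_nonneg (Nat.cast_nonneg k) hbx0
      have hmem : MvPolynomial.monomial (k • b) (1 : K) ∈ symbolicPower (C.edgeIdeal K) (k * n) := by
        refine monomial_mem_symbolicPower (fun c hc => ?_) _
        simpa [← Finset.mul_sum] using Nat.mul_le_mul_left k (hbc c hc)
      have := le_sum_of_mem_edgeIdeal_pow hx.1 (h (k * n) (k * n - 1) h0 (by omega) hmem) (k • b)
        (by simp [MvPolynomial.mem_support_iff])
      simpa [Finset.mul_sum, mul_assoc] using this
    rw [Nat.cast_sub hkn] at hle
    push_cast at hle
    linarith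
  obtain ⟨y, hy, hyx⟩ := hdom
  have hyQ := hhull hy
  have hxy : y = x := by
    -- `x` is the midpoint of `y` and `2x - y`; the latter dominates `x`, so it stays in the
    -- polyhedron.
    refine hx.2 hyQ (coveringPolyhedron_upper hx.1 (y := x + (x - y)) ?_) ?_
    · exact le_add_of_nonneg_right (sub_nonneg.2 hyx)
    · refine ⟨1 / 2, 1 / 2, by norm_num, by norm_num, by norm_num, ?_⟩
      funext v
      simp only [Pi.add_apply, Pi.smul_apply, Pi.sub_apply, smul_eq_mul]
      ring
  have hxF : x ∈ F := extremePoints_convexHull_subset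
    (inter_extremePoints_subset_extremePoints_of_subset hhull ⟨hxy ▸ hy, hx⟩)
  obtain ⟨c, -, rfl⟩ := hxF
  intro v
  by_cases hv : v ∈ c
  · exact ⟨1, by simp [hv]⟩
  · exact ⟨0, by simp [hv]⟩

/-- For an edge `e` of minimal size, the constant vector `1 / |e|` is in the covering polyhedron and
gives the `n`-th power of the monomial of `e` weight exactly `n`. -/
theorem not_pow_le_pow_succ (hne : C.edges.Nonempty) (hempty : ∅ ∉ C.edges) (n : ℕ) :
    ¬ C.edgeIdeal K ^ n ≤ C.edgeIdeal K ^ (n + 1) := by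
  classical
  intro h
  obtain ⟨e, he, hmin⟩ := C.edges.exists_min_image Finset.card hne
  have hcard : (0 : ℝ) < e.card := by
    exact_mod_cast Finset.card_pos.2
      (Finset.nonempty_iff_ne_empty.2 fun h0 : e = ∅ => hempty (h0 ▸ he))
  have hx : (fun _ => 1 / (e.card : ℝ)) ∈ C.coveringPolyhedron := by
    rw [mem_coveringPolyhedron]
    refine ⟨fun v => by positivity, fun e' he' => ?_⟩
    rw [Finset.sum_const, nsmul_eq_mul, mul_one_div, le_div_iff₀ hcard, one_mul]
    exact_mod_cast hmin e' he'
  have hmem := h (Ideal.pow_mem_pow (monomial_edgeExponent_mem K C he) n)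
  rw [MvPolynomial.monomial_pow] at hmem
  have := le_sum_of_mem_edgeIdeal_pow hx hmem (n • edgeExponent e)
    (by simp [MvPolynomial.mem_support_iff])
  have h2 := sum_edgeExponent_mul e (fun _ => 1 / (e.card : ℝ))
  rw [Finset.sum_const, nsmul_eq_mul, mul_one_div_cancel hcard.ne'] at h2
  simp only [Finsupp.smul_apply, smul_eq_mul, Nat.cast_mul, mul_assoc, ← Finset.mul_sum, h2] at this
  push_cast at this
  linarith

end Clutter

/-! ### Resurgence in terms of containments. -/

theorem resurgence_le_one_iff {R : Type*} [CommRing R] (I : Ideal R) :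
    resurgence I ≤ 1 ↔ ∀ r, 1 ≤ r → symbolicPower I (r + 1) ≤ I ^ r := by
  have hdiv : ∀ n r : ℕ, 1 ≤ r → ((n : ℝ≥0∞) / (r : ℝ≥0∞) ≤ 1 ↔ n ≤ r) := fun n r hr => by
    rw [ENNReal.div_le_iff (by simp; omega) (by simp), one_mul, Nat.cast_le]
  constructor
  · intro h r hr
    by_contra hnot
    have hle : ((r + 1 : ℕ) : ℝ≥0∞) / (r : ℝ≥0∞) ≤ resurgence I :=
      le_sSup ⟨r + 1, r, by omega, hr, hnot, rfl⟩
    have := (hdiv (r + 1) r hr).1 (hle.trans h)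
    omega
  · intro h
    refine sSup_le ?_
    rintro _ ⟨n, r, -, hr, hnot, rfl⟩
    rw [hdiv n r hr]
    -- Symbolic powers decrease, so among all `n > r` the containment for `n = r + 1` is the
    -- strongest.
    by_contra! hrn
    exact hnot ((symbolicPower_antitone I hrn).trans (h r hr))

theorem one_le_resurgence {R : Type*} [CommRing R] {I : Ideal R}
    (h : ∀ n, ¬ I ^ n ≤ I ^ (n + 1)) : 1 ≤ resurgence I := by
  refine ENNReal.le_of_forall_lt_one_mul_le fun a ha => ?_
  rw [mul_one]
  lift a to NNReal using ha.ne_top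
  have ha' : a < 1 := by exact_mod_cast ha
  -- The bound `n > a / (1 - a)` amounts to `a < n / (n + 1)`, a ratio occurring in the supremum.
  obtain ⟨n, hn⟩ := exists_nat_gt (a / (1 - a))
  have hpos : 0 < 1 - a := tsub_pos_of_lt ha'
  have hn0 : 1 ≤ n := by
    rcases Nat.eq_zero_or_pos n with rfl | h0
    · simp at hn
    · exact h0
  refine le_trans ?_ (le_sSup ⟨n, n + 1, hn0, by omega,
    fun hle => h n ((pow_le_symbolicPower I n).trans hle), rfl⟩)
  rw [ENNReal.le_div_iff_mul_le (by simp) (by simp)]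
  rw [div_lt_iff₀ hpos] at hn
  have : a * (n + 1) ≤ n := by
    have h1 : (n : NNReal) * (1 - a) + n * a = n := by
      rw [← mul_add, tsub_add_cancel_of_le ha'.le, mul_one]
    calc a * (n + 1) = a + n * a := by ring
      _ ≤ n * (1 - a) + n * a := by gcongr
      _ = n := h1
  exact_mod_cast this

theorem mainTheorem6 {K : Type*} [Field K] {s : ℕ} (C : Clutter (Fin s))
    (hne : C.edges.Nonempty) (hempty : ∅ ∉ C.edges) :
    resurgence (C.edgeIdeal K) = 1 ↔
      IsIntegralPolyhedron C.coveringPolyhedron ∧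
        ∀ r : ℕ, 1 ≤ r → r ≤ s - 1 →
          symbolicPower (C.edgeIdeal K) (r + 1) ≤ C.edgeIdeal K ^ r := by
  constructor
  · intro h
    have hle := (resurgence_le_one_iff _).1 h.le
    exact ⟨Clutter.isIntegralPolyhedron_of_symbolicPower_le hempty fun n r hr hrn =>
      (symbolicPower_antitone _ hrn).trans (hle r hr), fun r hr _ => hle r hr⟩
  · rintro ⟨hint, h⟩
    refine le_antisymm ((resurgence_le_one_iff _).2 fun r _ => ?_)
      (one_le_resurgence (Clutter.not_pow_le_pow_succ hne hempty))
    exact Clutter.symbolicPower_succ_le hne hint (by simpa using h) r
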